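/- Let $L$ be a finite relational vocabulary with at least one relation symbol of arity at least $2$. For an $L$-structure $\mathcal M$ with universe $M$, let $\mathrm{Spt}^*(\mathcal M)\subseteq M$ (the support of $\mathcal M$) be the set of elements that are moved by at least one automorphism of $\mathcal M$. A group of permutations of a set $\Omega$ has no fixed point if no $a\in\Omega$ is fixed by all members of the group. Let $\mathcal A$ be a finite $L$-structure with nonempty universe $A$ such that $\mathrm{Aut}(\mathcal A)$ has no fixed point, and let $H$ be a subgroup of $\mathrm{Aut}(\mathcal A)$ without any fixed point. For $n\ge 1$ let $\mathbf S_n(\mathcal A,H)$ be the set of all $L$-structures $\mathcal M$ with universe $[n]=\{1,\dots,n\}$ for which there is an embedding $f:\mathcal A\to\mathcal M$ whose image is $\mathrm{Spt}^*(\mathcal M)$ and such that \[ H_f=\{f\sigma f^{-1}:\sigma\in H\} \] is a subgroup of $\{g\restriction \mathrm{Spt}^*(\mathcal M): g\in\mathrm{Aut}(\mathcal M)\}$. Then $\mathbf S(\mathcal A,H)=\bigcup_{n\ge1}\mathbf S_n(\mathcal A,H)$ has a zero-one law: $\mathbf S_n(\mathcal A,H)$ is nonempty for all sufficiently large $n$,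 and for every first-order sentence $\varphi$ over $L$ the proportion \[ \frac{\big|\{\mathcal M\in\mathbf S_n(\mathcal A,H):\mathcal M\models\varphi\}\big|}{\big|\mathbf S_n(\mathcal A,H)\big|} \] converges, as $n\to\infty$, to $0$ or to $1$. -/

import Mathlib

open FirstOrder Filter Topology

namespace SupportZeroOne

universe u v w

/-- The automorphism group of an `L`-structure `M`, as a group of permutations of its universe. -/
def autGroup (L : FirstOrder.Language.{u, v}) (M : Type w) [L.Structure M] :
    Subgroup (Equiv.Perm M) where
  carrier := {g | ∃ e : M ≃[L] M, e.toEquiv = g}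
  one_mem' := ⟨FirstOrder.Language.Equiv.refl L M, rfl⟩
  mul_mem' := by
    rintro _ _ ⟨e, rfl⟩ ⟨e', rfl⟩
    exact ⟨e.comp e', rfl⟩
  inv_mem' := by
    rintro _ ⟨e, rfl⟩
    exact ⟨e.symm, rfl⟩

/-- The support of a structure: the elements that are moved by some automorphism. -/
def support (L : FirstOrder.Language.{u, v}) (M : Type w) [L.Structure M] : Set M :=
  {a | ∃ g ∈ autGroup L M, g a ≠ a}

/-- A permutation group has no fixed point if no element is fixed by all its members. -/
def HasNoFixedPoint {Ω : Type w} (H : Subgroup (Equiv.Perm Ω)) : Prop :=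
  ∀ a : Ω, ∃ h ∈ H, h a ≠ a

/-- There is an embedding `f` of `A` into `M` whose image is the support of `M` and such that every
`f σ f⁻¹` with `σ ∈ H` (a permutation of the image of `f`) is the restriction to the support of
some automorphism `g` of `M`; since `f` is a bijection from `A` onto the support, the equation
`f σ f⁻¹ = g` on the support is the equation `g ∘ f = f ∘ σ` on `A`. -/
def SupportedBy (L : FirstOrder.Language.{u, v}) (A : Type w) [L.Structure A]
    (H : Subgroup (Equiv.Perm A)) (M : Type*) [L.Structure M] : Prop :=
  ∃ f : A ↪[L] M, Set.range f = support L M ∧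
    ∀ σ ∈ H, ∃ g ∈ autGroup L M, ∀ a : A, g (f a) = f (σ a)

/-- The structures with universe `Fin n` that belong to the class `S(A, H)`. -/
def classS (L : FirstOrder.Language.{u, v}) (A : Type w) [L.Structure A]
    (H : Subgroup (Equiv.Perm A)) (n : ℕ) : Set (L.Structure (Fin n)) :=
  {S | @SupportedBy L A _ H (Fin n) S}

/-- Over a finite relational vocabulary there are only finitely many structures with a given
finite universe, so that the cardinalities in `proportion` below are honest ones. -/
theorem finite_structure (L : FirstOrder.Language.{u, v}) [L.IsRelational]
    [Finite (Σ k, L.Relations k)] (n : ℕ) : Finite (L.Structure (Fin n)) := by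
  let F : L.Structure (Fin n) →
      ((p : Σ k, L.Relations k) → (Fin p.1 → Fin n) → Prop) :=
    fun S p x => @FirstOrder.Language.Structure.RelMap L (Fin n) S p.1 p.2 x
  have hF : Function.Injective F := by
    intro S T h
    apply FirstOrder.Language.Structure.ext
    · funext k f
      exact isEmptyElim f
    · funext k R x
      exact congrFun (congrFun h ⟨k, R⟩) x
  exact Finite.of_injective F hF

/-- The proportion of members of `C` that satisfy the sentence `φ`. -/
noncomputable def proportion {L : FirstOrder.Language.{u, v}} {n : ℕ}
    (C : Set (L.Structure (Fin n))) (φ : L.Sentence) : ℝ :=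
  ({S ∈ C | @FirstOrder.Language.Sentence.Realize L (Fin n) S φ}.ncard : ℝ) / (C.ncard : ℝ)

/-- A class of finite structures, given by its sets of members with universe `Fin n`, has a
(labelled) zero-one law: the proportion of members of size `n` that satisfy a given first-order
sentence is defined for all large `n` and converges to `0` or to `1`. -/
def HasZeroOneLaw {L : FirstOrder.Language.{u, v}}
    (C : (n : ℕ) → Set (L.Structure (Fin n))) : Prop :=
  (∀ᶠ n in atTop, (C n).Nonempty) ∧
    ∀ φ : L.Sentence,
      Tendsto (fun n => proportion (C n) φ) atTop (𝓝 0) ∨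
        Tendsto (fun n => proportion (C n) φ) atTop (𝓝 1)

end SupportZeroOne

/-!
A structure in `S_n(A, H)` is the same as a structure `S` on `Fin n` for which there is an embedding
`f` of `A` such that `S` is invariant under the action of `H` transported along `f`
(`invariantStructures`) and no automorphism of `S` moves an element outside the range of `f`
(`rigidOutside`); see `mem_classS_iff`. For fixed `f`, a uniformly random invariant structure
arises by deciding independently, for every `H`-orbit of atoms that do not lie within the copy of
`A`, whether it holds. Two facts about this random structure, uniform in `f`, give the theorem.

*Extension axioms.* For fixed `k`, with probability tending to `1` every `H`-invariant type of a new
element over the named copy of `A` and `k` further elements is realized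
(`eventually_ncard_not_extensionAxiom_le`): different candidates `x` are independent, and each
succeeds with a probability that does not depend on `n`. Independence is used in the form of
`ncard_avoid_le`: a structure can be overwritten so that `x` realizes the type, with boundedly many
preimages and without influence on the other candidates. By a back-and-forth argument
(`exists_sentence_realize_iff`), structures that satisfy enough extension axioms agree on a given
sentence `φ`, even for different `n` and `f`. So either `φ` or its negation fails in all of them.

*Rigidity.* With probability tending to `1` no automorphism moves an element outside the range of
`f` (`eventually_ncard_not_rigidOutside_le`). If a permutation `g` moves `t ≥ 1` such elements,
then at least about `t n / 3` independent atoms `R(x, y, …, y)` of an invariant structure with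
automorphism `g` are determined by the others (`ncard_autGroup_mul_le`); this is where a relation
symbol of arity at least `2` is needed. The union bound over `g` then tends to `0`: it is dominated
by a sum over maps of weights that factor over the elements (`ncard_not_rigidOutside_le`).

It remains to pass from pairs `(f, S)` to structures `S`. All embeddings that belong to a given `S`
have its support as their range, so there are at most `|A| ^ |A|` of them (`sum_ncard_le`), and a
property that is negligible among the invariant structures for every `f` is negligible in
`S_n(A, H)` (`tendsto_proportion_zero`).
-/

namespace SupportZeroOne

universe u v w

/-! ### Structures given by their relations -/

section Structures

variable {L : FirstOrder.Language.{u, v}} {V : Type*}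

/-- The interpretation of a relation symbol in a structure that is passed explicitly. -/
def rel (S : L.Structure V) {k : ℕ} (R : L.Relations k) (s : Fin k → V) : Prop :=
  @FirstOrder.Language.Structure.RelMap L V S k R s

theorem structure_ext [L.IsRelational] {S T : L.Structure V}
    (h : ∀ k (R : L.Relations k) s, rel S R s ↔ rel T R s) : S = T := by
  apply FirstOrder.Language.Structure.ext
  · funext k f
    exact isEmptyElim f
  · funext k R s
    exact propext (h k R s)

/-- A structure for a relational vocabulary, given by its relations. -/
@[reducible]
def ofRel [L.IsRelational] (P : ∀ k, L.Relations k → (Fin k → V) → Prop) : L.Structure V where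
  funMap := fun f => isEmptyElim f
  RelMap := fun R => P _ R

@[simp]
theorem rel_ofRel [L.IsRelational] (P : ∀ k, L.Relations k → (Fin k → V) → Prop) {k : ℕ}
    (R : L.Relations k) (s : Fin k → V) : rel (ofRel P) R s ↔ P k R s := Iff.rfl

/-- The structure that follows the relations `P` on the tuples in `D` and the structure `S` on all
other tuples. -/
@[reducible]
def patch [L.IsRelational] (D P : ∀ k, L.Relations k → (Fin k → V) → Prop)
    (S : L.Structure V) : L.Structure V :=
  ofRel fun k R s => (D k R s ∧ P k R s) ∨ (¬ D k R s ∧ rel S R s)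

theorem rel_patch_of_mem [L.IsRelational] {D P : ∀ k, L.Relations k → (Fin k → V) → Prop}
    {S : L.Structure V} {k : ℕ} {R : L.Relations k} {s : Fin k → V} (h : D k R s) :
    rel (patch D P S) R s ↔ P k R s := by
  simp [patch, h]

theorem rel_patch_of_not_mem [L.IsRelational] {D P : ∀ k, L.Relations k → (Fin k → V) → Prop}
    {S : L.Structure V} {k : ℕ} {R : L.Relations k} {s : Fin k → V} (h : ¬ D k R s) :
    rel (patch D P S) R s ↔ rel S R s := by
  simp [patch, h]

theorem mem_autGroup_iff [L.IsRelational] {S : L.Structure V} {g : Equiv.Perm V} :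
    g ∈ @autGroup L V S ↔ ∀ k (R : L.Relations k) s, rel S R (g ∘ s) ↔ rel S R s := by
  constructor
  · rintro ⟨e, rfl⟩ k R s
    exact @FirstOrder.Language.Equiv.map_rel L V V S S e k R s
  · intro h
    exact ⟨@FirstOrder.Language.Equiv.mk L V V S S g (fun f _ => isEmptyElim f)
      (fun R s => h _ R s), rfl⟩

end Structures

/-! ### Invariant structures and the class `S(A, H)` -/

section Invariant

variable {L : FirstOrder.Language.{u, v}} {A : Type w} [L.Structure A] {V : Type*}

/-- The structures on `V` for which `f` is an embedding of `A` and which are invariant under the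
action of `H` on `V` that is transported along `f` on the range of `f` and trivial elsewhere. -/
def invariantStructures (L : FirstOrder.Language.{u, v}) {A : Type w} [L.Structure A] {V : Type*}
    (H : Subgroup (Equiv.Perm A)) (f : A ↪ V) : Set (L.Structure V) :=
  {S | (∀ k (R : L.Relations k) (t : Fin k → A),
      rel S R (f ∘ t) ↔ FirstOrder.Language.Structure.RelMap R t) ∧
    ∀ σ ∈ H, ∀ k (R : L.Relations k) (s : Fin k → V),
      rel S R (σ.viaEmbedding f ∘ s) ↔ rel S R s}

/-- The structures on `V` none of whose automorphisms moves an element outside the range of `f`. -/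
def rigidOutside (L : FirstOrder.Language.{u, v}) {A : Type w} {V : Type*} (f : A ↪ V) :
    Set (L.Structure V) :=
  {S | ∀ g ∈ @autGroup L V S, ∀ a ∉ Set.range f, g a = a}

theorem viaEmbedding_comp_embedding (f : A ↪ V) (σ : Equiv.Perm A) {κ : Type*} (t : κ → A) :
    σ.viaEmbedding f ∘ f ∘ t = f ∘ σ ∘ t :=
  funext fun _ => Equiv.Perm.viaEmbedding_apply _ _ _

/-- Patching an invariant structure with invariant data, off the tuples from the copy of `A`,
gives an invariant structure. -/
theorem patch_mem_invariantStructures [L.IsRelational] {H : Subgroup (Equiv.Perm A)} {f : A ↪ V}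
    {S : L.Structure V} (hS : S ∈ invariantStructures L H f)
    {D P : ∀ k, L.Relations k → (Fin k → V) → Prop}
    (hf : ∀ k (R : L.Relations k) (t : Fin k → A), ¬ D k R (f ∘ t))
    (hD : ∀ σ ∈ H, ∀ k (R : L.Relations k) (s : Fin k → V),
      D k R (σ.viaEmbedding f ∘ s) ↔ D k R s)
    (hP : ∀ σ ∈ H, ∀ k (R : L.Relations k) (s : Fin k → V), D k R s →
      (P k R (σ.viaEmbedding f ∘ s) ↔ P k R s)) :
    patch D P S ∈ invariantStructures L H f := by
  refine ⟨fun k R t => ?_, fun σ hσ k R s => ?_⟩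
  · rw [rel_patch_of_not_mem (hf k R t)]
    exact hS.1 k R t
  · by_cases h : D k R s
    · rw [rel_patch_of_mem h, rel_patch_of_mem ((hD σ hσ k R s).2 h)]
      exact hP σ hσ k R s h
    · rw [rel_patch_of_not_mem h, rel_patch_of_not_mem (mt (hD σ hσ k R s).1 h)]
      exact hS.2 σ hσ k R s

/-- The structure whose relations hold only within the copy of `A`, as they do in `A`, is
invariant. -/
theorem invariantStructures_nonempty [L.IsRelational] {H : Subgroup (Equiv.Perm A)}
    (hHA : H ≤ autGroup L A) (f : A ↪ V) : (invariantStructures L H f).Nonempty := by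
  refine ⟨ofRel fun k R s => ∃ t : Fin k → A, f ∘ t = s ∧
    FirstOrder.Language.Structure.RelMap R t, fun k R t => ?_, fun σ hσ k R s => ?_⟩
  · rw [rel_ofRel]
    constructor
    · rintro ⟨t', h, ht'⟩
      rwa [← f.injective.comp_left h]
    · exact fun h => ⟨t, rfl, h⟩
  · have hinv := mem_autGroup_iff.1 (hHA hσ) k R
    simp only [rel_ofRel]
    constructor
    · rintro ⟨t, h, ht⟩
      refine ⟨σ.symm ∘ t, ?_, ?_⟩
      · apply (σ.viaEmbedding f).injective.comp_left
        simp only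
        rw [viaEmbedding_comp_embedding, ← h]
        funext i
        simp
      · refine (hinv _).1 ?_
        have : σ ∘ σ.symm ∘ t = t := by funext i; simp
        rw [this]
        exact ht
    · rintro ⟨t, rfl, ht⟩
      exact ⟨σ ∘ t, (viaEmbedding_comp_embedding f σ t).symm, (hinv t).2 ht⟩

theorem range_eq_support [L.IsRelational] {H : Subgroup (Equiv.Perm A)} (hH : HasNoFixedPoint H)
    {f : A ↪ V} {S : L.Structure V} (hS : S ∈ invariantStructures L H f)
    (hr : S ∈ rigidOutside L f) : Set.range f = @support L V S := by
  apply Set.Subset.antisymm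
  · rintro _ ⟨a, rfl⟩
    obtain ⟨σ, hσ, ha⟩ := hH a
    refine ⟨σ.viaEmbedding f, mem_autGroup_iff.2 (hS.2 σ hσ), ?_⟩
    rw [Equiv.Perm.viaEmbedding_apply]
    exact fun h => ha (f.injective h)
  · rintro a ⟨g, hg, ha⟩
    by_contra h
    exact ha (hr g hg a h)

/-- Membership in the class `S(A, H)`, unfolded: an automorphism that induces `f σ f⁻¹` on the
support is trivial elsewhere, so it is the extension of `σ` along `f`; conversely, since `H` has no
fixed point, the range of `f` consists of moved elements. -/
theorem mem_classS_iff [L.IsRelational] {H : Subgroup (Equiv.Perm A)}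
    (hH : HasNoFixedPoint H) {n : ℕ} {S : L.Structure (Fin n)} :
    S ∈ classS L A H n ↔ ∃ f : A ↪ Fin n, S ∈ invariantStructures L H f ∧ S ∈ rigidOutside L f := by
  constructor
  · rintro ⟨f, hf, hσ⟩
    refine ⟨f.toEmbedding, ⟨fun k R t => f.map_rel R t, fun σ hs => ?_⟩, fun g hg a ha => ?_⟩
    · obtain ⟨g, hg, hgf⟩ := hσ σ hs
      have : σ.viaEmbedding f.toEmbedding = g := by
        ext1 a
        by_cases ha : a ∈ Set.range f
        · obtain ⟨b, rfl⟩ := ha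
          rw [hgf]
          exact Equiv.Perm.viaEmbedding_apply _ _ _
        · rw [Equiv.Perm.viaEmbedding_apply_of_notMem _ _ _ ha]
          rw [hf] at ha
          by_contra h
          exact ha ⟨g, hg, Ne.symm h⟩
      rw [this]
      exact mem_autGroup_iff.1 hg
    · by_contra h
      apply ha
      have : a ∈ @support L (Fin n) S := ⟨g, hg, h⟩
      rw [← hf] at this
      exact this
  · rintro ⟨f, ⟨hf, hinv⟩, hr⟩
    have haut : ∀ σ ∈ H, σ.viaEmbedding f ∈ @autGroup L (Fin n) S := fun σ hσ =>
      mem_autGroup_iff.2 (hinv σ hσ)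
    refine ⟨@FirstOrder.Language.Embedding.mk L A (Fin n) _ S f (fun g _ => isEmptyElim g)
      (fun R t => hf _ R t), ?_, fun σ hσ => ⟨_, haut σ hσ, fun a =>
        Equiv.Perm.viaEmbedding_apply _ _ _⟩⟩
    exact range_eq_support hH ⟨hf, hinv⟩ hr

end Invariant

/-! ### Counting structures that avoid independent events -/

section Counting

/-- Suppose that the events `E j` within `U` can be forced independently: `ov j` sends `U` into
`E j`, does not affect the other events, and becomes injective on `U` once a value in a type with
`C` elements is recorded. Then each event has conditional density at least `1 / C`, so that the
density of the set avoiding all of them is at most `(1 - 1 / C) ^ #J`. -/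
theorem ncard_avoid_le {α ι κ : Type*} [Finite α] [Finite κ] [Nonempty κ] (U : Set α)
    (E : ι → Set α) (ov : ι → α → α) (pat : ι → α → κ)
    (J : Finset ι) (hmem : ∀ j ∈ J, ∀ S ∈ U, ov j S ∈ U ∩ E j)
    (hother : ∀ j ∈ J, ∀ j' ∈ J, j' ≠ j → ∀ S ∈ U, ov j S ∈ E j' → S ∈ E j')
    (hinj : ∀ j ∈ J, Set.InjOn (fun S => (ov j S, pat j S)) U) :
    (({S ∈ U | ∀ j ∈ J, S ∉ E j}.ncard : ℕ) : ℝ) ≤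
      (1 - 1 / (Nat.card κ : ℝ)) ^ J.card * (U.ncard : ℝ) := by
  classical
  have hC : (1 : ℝ) ≤ Nat.card κ := by
    exact_mod_cast Nat.card_pos
  induction J using Finset.induction_on with
  | empty => simp
  | insert i J hi ih =>
    have ih := ih (fun j hj => hmem j (Finset.mem_insert_of_mem hj))
      (fun j hj j' hj' => hother j (Finset.mem_insert_of_mem hj) j' (Finset.mem_insert_of_mem hj'))
      (fun j hj => hinj j (Finset.mem_insert_of_mem hj))
    set N := {S ∈ U | ∀ j ∈ J, S ∉ E j} with hN
    have h1 : {S ∈ U | ∀ j ∈ insert i J, S ∉ E j} = N \ E i := by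
      ext S
      simp only [hN, Finset.mem_insert, Set.mem_ofPred_eq, Set.mem_sdiff, forall_eq_or_imp]
      tauto
    have h2 : N.ncard ≤ (N ∩ E i).ncard * Nat.card κ := by
      rw [← Set.ncard_univ κ, ← Set.ncard_prod]
      refine Set.ncard_le_ncard_of_injOn (fun S => (ov i S, pat i S)) ?_
        ((hinj i (Finset.mem_insert_self _ _)).mono fun S hS => hS.1)
      intro S hS
      have := hmem i (Finset.mem_insert_self _ _) S hS.1
      refine ⟨⟨⟨this.1, fun j hj h => hS.2 j hj ?_⟩, this.2⟩, Set.mem_univ _⟩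
      exact hother i (Finset.mem_insert_self _ _) j (Finset.mem_insert_of_mem hj)
        (fun h => hi (h ▸ hj)) S hS.1 h
    have h3 : (N ∩ E i).ncard + (N \ E i).ncard = N.ncard :=
      Set.ncard_inter_add_ncard_sdiff_eq_ncard
        _ _
    have h2' : (N.ncard : ℝ) ≤ (N ∩ E i).ncard * Nat.card κ := by exact_mod_cast h2
    have h3' : ((N ∩ E i).ncard : ℝ) + (N \ E i).ncard = N.ncard := by exact_mod_cast h3
    rw [h1, Finset.card_insert_of_notMem hi, pow_succ']
    have h4 : ((N \ E i).ncard : ℝ) ≤ (1 - 1 / (Nat.card κ : ℝ)) * N.ncard := by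
      have : (N.ncard : ℝ) / Nat.card κ ≤ (N ∩ E i).ncard := by
        rw [div_le_iff₀ (by linarith)]
        exact h2'
      have e : (1 - 1 / (Nat.card κ : ℝ)) * N.ncard = N.ncard - N.ncard / Nat.card κ := by ring
      linarith
    have h5 : (0 : ℝ) ≤ 1 - 1 / (Nat.card κ : ℝ) := by
      rw [sub_nonneg, div_le_one (by linarith)]
      exact hC
    calc ((N \ E i).ncard : ℝ) ≤ (1 - 1 / (Nat.card κ : ℝ)) * N.ncard := h4
      _ ≤ _ := by
        rw [mul_assoc]
        exact mul_le_mul_of_nonneg_left ih h5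

end Counting

/-! ### Extension axioms and the back-and-forth argument -/

section Extension

variable {L : FirstOrder.Language.{u, v}} {A : Type w} {V V' : Type*}

/-- In the structure `S`, the element `x` is related to the elements of `A` (named along `f`) and to
`ys` in the same way as the last element of `A ⊕ Fin (k + 1)` is related to the others in `Q`. -/
def RealizesType (f : A ↪ V) {k : ℕ} (ys : Fin k → V) (Q : L.Structure (A ⊕ Fin (k + 1)))
    (x : V) : Set (L.Structure V) :=
  {S | ∀ r (R : L.Relations r) (t : Fin r → A ⊕ Fin (k + 1)), Sum.inr (Fin.last k) ∈ Set.range t →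
    (rel S R (Sum.elim f (Fin.snoc (α := fun _ => V) ys x) ∘ t) ↔ rel Q R t)}

/-- The extension axiom for `k` parameters over the named copy of `A`: every type of a new element
over `A` and `k` further distinct elements that is compatible with the invariance under `H` is
realized. -/
def extensionAxiom (L : FirstOrder.Language.{u, v}) {A : Type w} [L.Structure A] {V : Type*}
    (H : Subgroup (Equiv.Perm A)) (f : A ↪ V) (k : ℕ) : Set (L.Structure V) :=
  {S | ∀ ys : Fin k → V, Function.Injective (Sum.elim f ys) →
    ∀ Q ∈ invariantStructures L H (Function.Embedding.inl : A ↪ A ⊕ Fin (k + 1)),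
      ∃ x ∉ Set.range (Sum.elim f ys), S ∈ RealizesType f ys Q x}

/-- An injection over `A` commutes with the actions transported from `A`. -/
theorem comp_viaEmbedding {B : Type*} {f : A ↪ V} {j : A ↪ B} {e : B → V}
    (he : Function.Injective e) (hej : ∀ a, e (j a) = f a) (σ : Equiv.Perm A) {κ : Type*}
    (t : κ → B) : e ∘ σ.viaEmbedding j ∘ t = σ.viaEmbedding f ∘ e ∘ t := by
  funext i
  simp only [Function.comp_apply]
  by_cases h : t i ∈ Set.range j
  · obtain ⟨a, ha⟩ := h
    rw [← ha, Equiv.Perm.viaEmbedding_apply, hej, hej, Equiv.Perm.viaEmbedding_apply]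
  · rw [Equiv.Perm.viaEmbedding_apply_of_notMem _ _ _ h, Equiv.Perm.viaEmbedding_apply_of_notMem]
    rintro ⟨a, ha⟩
    rw [← hej] at ha
    exact h ⟨a, he ha⟩

theorem injective_sumElim_snoc {f : A ↪ V} {k : ℕ} {ys : Fin k → V} {x : V}
    (h : Function.Injective (Sum.elim f ys)) (hx : x ∉ Set.range (Sum.elim f ys)) :
    Function.Injective (Sum.elim f (Fin.snoc (α := fun _ => V) ys x)) := by
  refine f.injective.sumElim ?_ ?_
  · refine Fin.snoc_injective_of_injective (fun i j hij => ?_) ?_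
    · exact Sum.inr_injective (h (a₁ := Sum.inr i) (a₂ := Sum.inr j) hij)
    · rintro ⟨i, rfl⟩
      exact hx ⟨Sum.inr i, rfl⟩
  · intro a b
    refine Fin.lastCases ?_ (fun i => ?_) b
    · rw [Fin.snoc_last]
      rintro rfl
      exact hx ⟨Sum.inl a, rfl⟩
    · rw [Fin.snoc_castSucc]
      intro hab
      exact Sum.inl_ne_inr (h (a₁ := Sum.inl a) (a₂ := Sum.inr i) hab)

theorem sumElim_snoc_comp (f : A ↪ V) {k : ℕ} (ys : Fin k → V) (x : V) {κ : Type*}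
    (t : κ → A ⊕ Fin k) :
    Sum.elim f (Fin.snoc (α := fun _ => V) ys x) ∘ Sum.map id Fin.castSucc ∘ t =
      Sum.elim f ys ∘ t := by
  funext i
  simp only [Function.comp_apply]
  rcases t i with a | b <;> simp

/-- The positions of the back-and-forth game in which `k` pairs of distinct elements outside the
copies of `A` have been chosen and the resulting map is a partial isomorphism. -/
structure Position (f : A ↪ V) (f' : A ↪ V') (S : L.Structure V) (S' : L.Structure V') (k : ℕ)
    (ys : Fin k → V) (ys' : Fin k → V') : Prop where
  inj : Function.Injective (Sum.elim f ys)
  inj' : Function.Injective (Sum.elim f' ys')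
  rel_iff : ∀ r (R : L.Relations r) (t : Fin r → A ⊕ Fin k),
    rel S R (Sum.elim f ys ∘ t) ↔ rel S' R (Sum.elim f' ys' ∘ t)

theorem Position.symm {f : A ↪ V} {f' : A ↪ V'} {S : L.Structure V} {S' : L.Structure V'} {k : ℕ}
    {ys : Fin k → V} {ys' : Fin k → V'} (p : Position f f' S S' k ys ys') :
    Position f' f S' S k ys' ys :=
  ⟨p.inj', p.inj, fun r R t => (p.rel_iff r R t).symm⟩

/-- A new element `x` can be answered: as the structure `S` is invariant, the type of `x` is one of
those that the extension axiom for `S'` provides for. -/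
theorem Position.forth [L.IsRelational] [L.Structure A] {H : Subgroup (Equiv.Perm A)}
    {f : A ↪ V} {f' : A ↪ V'} {S : L.Structure V} {S' : L.Structure V'}
    (hS : S ∈ invariantStructures L H f) {k : ℕ}
    (hS' : S' ∈ extensionAxiom L H f' k)
    {ys : Fin k → V} {ys' : Fin k → V'} (p : Position f f' S S' k ys ys') {x : V}
    (hx : x ∉ Set.range (Sum.elim f ys)) :
    ∃ x', Position f f' S S' (k + 1) (Fin.snoc (α := fun _ => V) ys x)
      (Fin.snoc (α := fun _ => V') ys' x') := by
  have hinj := injective_sumElim_snoc p.inj hx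
  -- the type to be realized is the one of `x`
  obtain ⟨x', hx', hr⟩ := hS' ys' p.inj'
    (ofRel fun r R t => rel S R (Sum.elim f (Fin.snoc (α := fun _ => V) ys x) ∘ t))
    ⟨fun r R t => hS.1 r R t, fun σ hσ r R t => by
      rw [rel_ofRel, rel_ofRel, comp_viaEmbedding hinj (f := f) (fun a => rfl)]
      exact hS.2 σ hσ r R _⟩
  refine ⟨x', hinj, injective_sumElim_snoc p.inj' hx', fun r R t => ?_⟩
  by_cases ht : Sum.inr (Fin.last k) ∈ Set.range t
  · exact (hr r R t ht).symm
  · have : ∀ i, ∃ b : A ⊕ Fin k, Sum.map id Fin.castSucc b = t i := by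
      intro i
      rcases h : t i with a | b
      · exact ⟨Sum.inl a, rfl⟩
      · induction b using Fin.lastCases with
        | last => exact absurd ⟨i, h⟩ ht
        | cast b => exact ⟨Sum.inr b, rfl⟩
    choose t' ht' using this
    obtain rfl : Sum.map id Fin.castSucc ∘ t' = t := funext ht'
    rw [sumElim_snoc_comp, sumElim_snoc_comp]
    exact p.rel_iff r R t'

/-- The back-and-forth argument: structures with enough extension axioms agree on a formula at
corresponding tuples of a position. -/
theorem exists_realize_iff [L.IsRelational] [L.Structure A] (H : Subgroup (Equiv.Perm A)) {l : ℕ}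
    (φ : L.BoundedFormula Empty l) : ∃ d : ℕ, ∀ (V V' : Type) (f : A ↪ V) (f' : A ↪ V')
      (S : L.Structure V) (S' : L.Structure V') (N k : ℕ) (ys : Fin k → V) (ys' : Fin k → V')
      (xs : Fin l → A ⊕ Fin k),
      S ∈ invariantStructures L H f → S' ∈ invariantStructures L H f' →
      (∀ j < N, S ∈ extensionAxiom L H f j) → (∀ j < N, S' ∈ extensionAxiom L H f' j) →
      k + d ≤ N → Position f f' S S' k ys ys' →
      (@FirstOrder.Language.BoundedFormula.Realize L V S _ _ φ default (Sum.elim f ys ∘ xs) ↔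
        @FirstOrder.Language.BoundedFormula.Realize L V' S' _ _ φ default
          (Sum.elim f' ys' ∘ xs)) := by
  have hterm : ∀ {l : ℕ} (t : L.Term (Empty ⊕ Fin l)), 
      ∃ i, t = FirstOrder.Language.Term.var (Sum.inr i) := by
    intro l t
    cases t with
    | var a =>
      rcases a with a | a
      · exact a.elim
      · exact ⟨a, rfl⟩
    | func g _ => exact isEmptyElim g
  induction φ with
  | falsum => exact ⟨0, fun V V' f f' S S' N k ys ys' xs _ _ _ _ _ _ => Iff.rfl⟩
  | equal t₁ t₂ =>
    refine ⟨0, fun V V' f f' S S' N k ys ys' xs _ _ _ _ _ p => ?_⟩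
    obtain ⟨i, rfl⟩ := hterm t₁
    obtain ⟨j, rfl⟩ := hterm t₂
    exact (p.inj.eq_iff (a := xs i) (b := xs j)).trans
      (p.inj'.eq_iff (a := xs i) (b := xs j)).symm
  | rel R ts =>
    refine ⟨0, fun V V' f f' S S' N k ys ys' xs _ _ _ _ _ p => ?_⟩
    choose i hi using fun j => hterm (ts j)
    obtain rfl : ts = fun j => FirstOrder.Language.Term.var (Sum.inr (i j)) := funext hi
    exact p.rel_iff _ R (xs ∘ i)
  | imp φ ψ ih₁ ih₂ =>
    obtain ⟨d₁, h₁⟩ := ih₁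
    obtain ⟨d₂, h₂⟩ := ih₂
    refine ⟨max d₁ d₂, fun V V' f f' S S' N k ys ys' xs hS hS' hN hN' hk p => ?_⟩
    exact imp_congr (h₁ V V' f f' S S' N k ys ys' xs hS hS' hN hN' (by omega) p)
      (h₂ V V' f f' S S' N k ys ys' xs hS hS' hN hN' (by omega) p)
  | @all l φ ih =>
    obtain ⟨d, h⟩ := ih
    refine ⟨d + 1, fun V V' f f' S S' N k ys ys' xs hS hS' hN hN' hk p => ?_⟩
    -- one direction suffices, as positions are symmetric
    have key : ∀ (V V' : Type) (f : A ↪ V) (f' : A ↪ V')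
        (S : L.Structure V) (S' : L.Structure V') (ys : Fin k → V) (ys' : Fin k → V'),
        S ∈ invariantStructures L H f → S' ∈ invariantStructures L H f' →
        (∀ j < N, S ∈ extensionAxiom L H f j) → (∀ j < N, S' ∈ extensionAxiom L H f' j) →
        Position f f' S S' k ys ys' →
        @FirstOrder.Language.BoundedFormula.Realize L V' S' _ _ φ.all default
          (Sum.elim f' ys' ∘ xs) →
        @FirstOrder.Language.BoundedFormula.Realize L V S _ _ φ.all default
          (Sum.elim f ys ∘ xs) := by
      intro V V' f f' S S' ys ys' hS hS' hN hN' p hall x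
      by_cases hx : x ∈ Set.range (Sum.elim f ys)
      · obtain ⟨b, rfl⟩ := hx
        have := (h V V' f f' S S' N k ys ys' (Fin.snoc (α := fun _ => A ⊕ Fin k) xs b)
          hS hS' hN hN' (by omega) p).2
        rw [Fin.comp_snoc, Fin.comp_snoc] at this
        exact this (hall _)
      · obtain ⟨x', p'⟩ := p.forth hS (hN' k (by omega)) hx
        have := (h V V' f f' S S' N (k + 1) _ _ (Fin.snoc (α := fun _ => A ⊕ Fin (k + 1))
          (Sum.map id Fin.castSucc ∘ xs) (Sum.inr (Fin.last k))) hS hS' hN hN' (by omega) p').2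
        rw [Fin.comp_snoc, Fin.comp_snoc, sumElim_snoc_comp, sumElim_snoc_comp] at this
        simp only [Sum.elim_inr, Fin.snoc_last] at this
        exact this (hall x')
    exact ⟨key V' V f' f S' S ys' ys hS' hS hN' hN p.symm,
      key V V' f f' S S' ys ys' hS hS' hN hN' p⟩

/-- Structures with enough extension axioms satisfy the same instances of a given sentence. -/
theorem exists_sentence_realize_iff [L.IsRelational] [L.Structure A] (H : Subgroup (Equiv.Perm A))
    (φ : L.Sentence) : ∃ N : ℕ, ∀ (V V' : Type) (f : A ↪ V) (f' : A ↪ V')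
      (S : L.Structure V) (S' : L.Structure V'),
      S ∈ invariantStructures L H f → S' ∈ invariantStructures L H f' →
      (∀ j < N, S ∈ extensionAxiom L H f j) → (∀ j < N, S' ∈ extensionAxiom L H f' j) →
      (@FirstOrder.Language.Sentence.Realize L V S φ ↔
        @FirstOrder.Language.Sentence.Realize L V' S' φ) := by
  obtain ⟨d, h⟩ := exists_realize_iff H φ
  refine ⟨d, fun V V' f f' S S' hS hS' hd hd' => ?_⟩
  have hinj : ∀ {V : Type} (f : A ↪ V), Function.Injective (Sum.elim f (Fin.elim0 : Fin 0 → V)) :=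
    fun f => f.injective.sumElim (fun i => i.elim0) (fun _ i => i.elim0)
  have p : Position f f' S S' 0 Fin.elim0 Fin.elim0 := by
    refine ⟨hinj f, hinj f', fun r R t => ?_⟩
    have : ∀ i, ∃ a, t i = Sum.inl a := fun i => by
      rcases t i with a | b
      · exact ⟨a, rfl⟩
      · exact b.elim0
    choose t' ht' using this
    obtain rfl : t = Sum.inl ∘ t' := funext ht'
    exact (hS.1 r R t').trans (hS'.1 r R t').symm
  have := h V V' f f' S S' d 0 Fin.elim0 Fin.elim0 Fin.elim0 hS hS' hd hd' (by omega) p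
  rwa [Subsingleton.elim (Sum.elim f Fin.elim0 ∘ Fin.elim0) default,
    Subsingleton.elim (Sum.elim f' Fin.elim0 ∘ Fin.elim0) default] at this

end Extension

/-! ### Almost all invariant structures satisfy the extension axioms -/

section ExtensionProbability

theorem ncard_le_sum_of_subset_iUnion {α ι : Type*} [Finite α] [Fintype ι] {s : Set α}
    {t : ι → Set α} (h : s ⊆ ⋃ i, t i) : s.ncard ≤ ∑ i, (t i).ncard := by
  classical
  have key : ∀ J : Finset ι, (⋃ i ∈ J, t i).ncard ≤ ∑ i ∈ J, (t i).ncard := by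
    intro J
    induction J using Finset.induction_on with
    | empty => simp
    | insert i J hi ih =>
      rw [Finset.set_biUnion_insert, Finset.sum_insert hi]
      exact (Set.ncard_union_le _ _).trans (by omega)
  have := key Finset.univ
  simp only [Finset.mem_univ, Set.iUnion_true] at this
  exact (Set.ncard_le_ncard h).trans this

variable {L : FirstOrder.Language.{u, v}} {A : Type w}

instance finite_structure_of_finite [L.IsRelational] [Finite (Σ k, L.Relations k)] {V : Type*}
    [Finite V] : Finite (L.Structure V) := by
  refine Finite.of_injective (β := (p : Σ k, L.Relations k) → (Fin p.1 → V) → Prop)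
    (fun S p s => rel S p.2 s) fun S T h => structure_ext fun k R s => ?_
  exact iff_of_eq (congrFun (congrFun h ⟨k, R⟩) s)

section Overwrite

variable [L.IsRelational] {V : Type*} (f : A ↪ V) {k : ℕ} (ys : Fin k → V)
  (Q : L.Structure (A ⊕ Fin (k + 1)))

/-- Overwriting a structure so that `x` realizes the type given by `Q`. -/
@[reducible]
def overwrite (x : V) (S : L.Structure V) : L.Structure V :=
  patch
    (fun r _ s => ∃ t : Fin r → A ⊕ Fin (k + 1), Sum.inr (Fin.last k) ∈ Set.range t ∧
      Sum.elim f (Fin.snoc (α := fun _ => V) ys x) ∘ t = s)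
    (fun r R s => ∃ t : Fin r → A ⊕ Fin (k + 1),
      Sum.elim f (Fin.snoc (α := fun _ => V) ys x) ∘ t = s ∧ rel Q R t) S

variable {f ys Q}

theorem viaEmbedding_inl_inr {B : Type*} (σ : Equiv.Perm A) (b : B) :
    σ.viaEmbedding (Function.Embedding.inl : A ↪ A ⊕ B) (Sum.inr b) = Sum.inr b :=
  Equiv.Perm.viaEmbedding_apply_of_notMem _ _ _ (by simp)

theorem overwrite_mem [L.Structure A] {H : Subgroup (Equiv.Perm A)} {S : L.Structure V}
    (hS : S ∈ invariantStructures L H f)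
    (hQ : Q ∈ invariantStructures L H (Function.Embedding.inl : A ↪ A ⊕ Fin (k + 1)))
    (hys : Function.Injective (Sum.elim f ys)) {x : V} (hx : x ∉ Set.range (Sum.elim f ys)) :
    overwrite f ys Q x S ∈ invariantStructures L H f := by
  have hinj := injective_sumElim_snoc hys hx
  have hcomp := fun (σ : Equiv.Perm A) (r : ℕ) (t : Fin r → A ⊕ Fin (k + 1)) =>
    comp_viaEmbedding (f := f) (j := Function.Embedding.inl) hinj (fun a => rfl) σ t
  apply patch_mem_invariantStructures hS
  · rintro r R t ⟨t', ⟨i, hi⟩, h⟩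
    have := congrFun h i
    simp only [Function.comp_apply, hi, Sum.elim_inr, Fin.snoc_last] at this
    exact hx ⟨Sum.inl (t i), this.symm⟩
  · intro σ _ r R s
    constructor
    · rintro ⟨t, ⟨i, hi⟩, h⟩
      refine ⟨(σ.viaEmbedding Function.Embedding.inl).symm ∘ t, ⟨i, ?_⟩, ?_⟩
      · rw [Function.comp_apply, hi, Equiv.symm_apply_eq, viaEmbedding_inl_inr]
      · apply (σ.viaEmbedding f).injective.comp_left
        change σ.viaEmbedding f ∘ _ = σ.viaEmbedding f ∘ _
        rw [← hcomp, ← h]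
        funext i
        simp
    · rintro ⟨t, ⟨i, hi⟩, rfl⟩
      exact ⟨σ.viaEmbedding Function.Embedding.inl ∘ t,
        ⟨i, by rw [Function.comp_apply, hi, viaEmbedding_inl_inr]⟩, hcomp _ _ _⟩
  · rintro σ hσ r R s ⟨t, -, rfl⟩
    rw [← hcomp]
    constructor
    · rintro ⟨t', h, ht'⟩
      obtain rfl := hinj.comp_left h
      exact ⟨t, rfl, (hQ.2 σ hσ r R t).1 ht'⟩
    · rintro ⟨t', h, ht'⟩
      obtain rfl := hinj.comp_left h
      exact ⟨_, rfl, (hQ.2 σ hσ r R t').2 ht'⟩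

theorem overwrite_realizesType (S : L.Structure V)
    (hys : Function.Injective (Sum.elim f ys)) {x : V} (hx : x ∉ Set.range (Sum.elim f ys)) :
    overwrite f ys Q x S ∈ RealizesType f ys Q x := by
  intro r R t ht
  rw [rel_patch_of_mem ⟨t, ht, rfl⟩]
  constructor
  · rintro ⟨t', h, ht'⟩
    rwa [← (injective_sumElim_snoc hys hx).comp_left h]
  · exact fun h => ⟨t, rfl, h⟩

/-- Whether `x'` realizes a type depends only on tuples that contain `x'`; none of these is
affected by overwriting for a different `x`. -/
theorem realizesType_of_overwrite {S : L.Structure V} {x x' : V}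
    (hx : x ∉ Set.range (Sum.elim f ys)) (hne : x' ≠ x)
    (h : overwrite f ys Q x S ∈ RealizesType f ys Q x') : S ∈ RealizesType f ys Q x' := by
  intro r R t ht
  rw [← h r R t ht, rel_patch_of_not_mem]
  rintro ⟨t', ⟨j, hj⟩, h'⟩
  have := congrFun h' j
  simp only [Function.comp_apply, hj, Sum.elim_inr, Fin.snoc_last] at this
  rcases htj : t j with a | b
  · rw [htj] at this
    exact hx ⟨Sum.inl a, this.symm⟩
  · rw [htj] at this
    induction b using Fin.lastCases with
    | last =>
      rw [Sum.elim_inr, Fin.snoc_last] at this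
      exact hne this.symm
    | cast b =>
      rw [Sum.elim_inr, Fin.snoc_castSucc] at this
      exact hx ⟨Sum.inr b, this.symm⟩

/-- The structure is recovered from the overwritten one and the atoms that were overwritten. -/
theorem overwrite_injective (x : V) : Function.Injective fun S : L.Structure V =>
    (overwrite f ys Q x S, fun (p : Σ r, L.Relations r) (t : Fin p.1 → A ⊕ Fin (k + 1)) =>
      rel S p.2 (Sum.elim f (Fin.snoc (α := fun _ => V) ys x) ∘ t)) := by
  intro S S' h
  obtain ⟨h₁, h₂⟩ := Prod.ext_iff.1 h
  refine structure_ext fun r R s => ?_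
  by_cases hs : ∃ t : Fin r → A ⊕ Fin (k + 1), Sum.inr (Fin.last k) ∈ Set.range t ∧
      Sum.elim f (Fin.snoc (α := fun _ => V) ys x) ∘ t = s
  · obtain ⟨t, -, rfl⟩ := hs
    exact iff_of_eq (congrFun (congrFun h₂ ⟨r, R⟩) t)
  · have h₃ : rel (overwrite f ys Q x S) R s ↔ rel (overwrite f ys Q x S') R s :=
      iff_of_eq (congrArg (fun T => rel T R s) h₁)
    rwa [rel_patch_of_not_mem hs, rel_patch_of_not_mem hs] at h₃

end Overwrite

variable [L.Structure A] [L.IsRelational] [Finite (Σ k, L.Relations k)] [Finite A]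

/-- For given parameters and a given type, the candidates for a realization outside the parameters
are independent; the union bound over all parameters and types gives exponential decay. -/
theorem ncard_not_extensionAxiom_le (H : Subgroup (Equiv.Perm A)) (k : ℕ) :
    ∃ C ρ : ℝ, 0 < ρ ∧ ρ < 1 ∧ ∀ (n : ℕ) (f : A ↪ Fin n),
      ({S ∈ invariantStructures L H f | S ∉ extensionAxiom L H f k}.ncard : ℝ) ≤
        (n : ℝ) ^ k * C * ρ ^ (n - (Nat.card A + k)) * ((invariantStructures L H f).ncard : ℝ) := by
  classical
  have := Fintype.ofFinite A
  have := Fintype.ofFinite (L.Structure (A ⊕ Fin (k + 1)))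
  let κ := (p : Σ r, L.Relations r) → (Fin p.1 → A ⊕ Fin (k + 1)) → Prop
  have hκ : (0 : ℝ) < Nat.card κ := by exact_mod_cast Nat.card_pos
  have hκ1 : (1 : ℝ) ≤ Nat.card κ := by exact_mod_cast Nat.card_pos (α := κ)
  have h0 : (0 : ℝ) ≤ 1 - 1 / (Nat.card κ : ℝ) := by
    rw [sub_nonneg, div_le_one hκ]
    exact hκ1
  refine ⟨Fintype.card (L.Structure (A ⊕ Fin (k + 1))), max (1 - 1 / (Nat.card κ : ℝ)) (1 / 2),
    by positivity, max_lt (by linarith [one_div_pos.2 hκ]) (by norm_num), fun n f => ?_⟩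
  set ρ : ℝ := max (1 - 1 / (Nat.card κ : ℝ)) (1 / 2) with hρ
  have hρ1 : ρ ≤ 1 := max_le (by linarith [one_div_pos.2 hκ]) (by norm_num)
  have hρ0 : 0 ≤ ρ := h0.trans (le_max_left _ _)
  set U := invariantStructures L H f with hU
  let bad : (Fin k → Fin n) × L.Structure (A ⊕ Fin (k + 1)) → Set (L.Structure (Fin n)) :=
    fun p => {S | S ∈ U ∧ Function.Injective (Sum.elim f p.1) ∧
      p.2 ∈ invariantStructures L H (Function.Embedding.inl : A ↪ A ⊕ Fin (k + 1)) ∧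
      ∀ x ∉ Set.range (Sum.elim f p.1), S ∉ RealizesType f p.1 p.2 x}
  have hcover : {S ∈ U | S ∉ extensionAxiom L H f k} ⊆ ⋃ p, bad p := by
    rintro S ⟨hSU, hS⟩
    simp only [extensionAxiom, Set.mem_ofPred_eq] at hS
    push Not at hS
    obtain ⟨ys, hys, Q, hQ, hx⟩ := hS
    exact Set.mem_iUnion.2 ⟨(ys, Q), hSU, hys, hQ, hx⟩
  have hbad : ∀ p, ((bad p).ncard : ℝ) ≤ ρ ^ (n - (Nat.card A + k)) * (U.ncard : ℝ) := by
    rintro ⟨ys, Q⟩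
    by_cases hp : Function.Injective (Sum.elim f ys) ∧
        Q ∈ invariantStructures L H (Function.Embedding.inl : A ↪ A ⊕ Fin (k + 1))
    · obtain ⟨hys, hQ⟩ := hp
      let J : Finset (Fin n) := (Finset.univ.image (Sum.elim f ys))ᶜ
      have hJ : ∀ x, x ∈ J ↔ x ∉ Set.range (Sum.elim f ys) := fun x => by simp [J]
      have hJcard : J.card = n - (Nat.card A + k) := by
        rw [Finset.card_compl, Finset.card_image_of_injective _ hys, Finset.card_univ,
          Fintype.card_fin, Fintype.card_sum, Fintype.card_fin, Nat.card_eq_fintype_card]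
      have h := ncard_avoid_le (κ := κ) U (RealizesType f ys Q) (overwrite f ys Q)
        (fun x S p t => rel S p.2 (Sum.elim f (Fin.snoc (α := fun _ => Fin n) ys x) ∘ t)) J
        (fun x hx S hS => ⟨overwrite_mem hS hQ hys ((hJ x).1 hx),
          overwrite_realizesType S hys ((hJ x).1 hx)⟩)
        (fun x hx x' _ hne S _ => realizesType_of_overwrite ((hJ x).1 hx) hne)
        (fun x _ => (overwrite_injective x).injOn)
      have hsub : bad (ys, Q) ⊆ {S ∈ U | ∀ x ∈ J, S ∉ RealizesType f ys Q x} :=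
        fun S hS => ⟨hS.1, fun x hx => hS.2.2.2 x ((hJ x).1 hx)⟩
      have hsub' : ((bad (ys, Q)).ncard : ℝ) ≤
          ({S ∈ U | ∀ x ∈ J, S ∉ RealizesType f ys Q x}.ncard : ℝ) := by
        exact_mod_cast Set.ncard_le_ncard hsub
      refine hsub'.trans (h.trans ?_)
      rw [hJcard]
      exact mul_le_mul_of_nonneg_right (pow_le_pow_left₀ h0 (le_max_left _ _) _) (Nat.cast_nonneg _)
    · have : bad (ys, Q) = ∅ := by
        ext S
        simp only [Set.mem_empty_iff_false, iff_false]
        exact fun hS => hp ⟨hS.2.1, hS.2.2.1⟩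
      rw [this, Set.ncard_empty, Nat.cast_zero]
      positivity
  calc ({S ∈ U | S ∉ extensionAxiom L H f k}.ncard : ℝ) ≤ ∑ p, ((bad p).ncard : ℝ) := by
        exact_mod_cast ncard_le_sum_of_subset_iUnion hcover
    _ ≤ ∑ _p : (Fin k → Fin n) × L.Structure (A ⊕ Fin (k + 1)),
        ρ ^ (n - (Nat.card A + k)) * (U.ncard : ℝ) := Finset.sum_le_sum fun p _ => hbad p
    _ = _ := by
        rw [Finset.sum_const, Finset.card_univ, Fintype.card_prod, Fintype.card_fun,
          Fintype.card_fin, Fintype.card_fin, nsmul_eq_mul]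
        push_cast
        ring

theorem eventually_ncard_not_extensionAxiom_le (H : Subgroup (Equiv.Perm A)) (k : ℕ) {ε : ℝ}
    (hε : 0 < ε) : ∀ᶠ n : ℕ in atTop, ∀ f : A ↪ Fin n,
      ({S ∈ invariantStructures L H f | S ∉ extensionAxiom L H f k}.ncard : ℝ) ≤
        ε * ((invariantStructures L H f).ncard : ℝ) := by
  obtain ⟨C, ρ, hρ0, hρ1, h⟩ := ncard_not_extensionAxiom_le (L := L) H k
  have ht : Tendsto (fun n : ℕ => (n : ℝ) ^ k * ρ ^ n * (C / ρ ^ (Nat.card A + k))) atTop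
      (𝓝 (0 * (C / ρ ^ (Nat.card A + k)))) :=
    (tendsto_pow_const_mul_const_pow_of_abs_lt_one k
      (by rwa [abs_of_pos hρ0])).mul_const _
  rw [zero_mul] at ht
  filter_upwards [ht.eventually_lt_const hε, eventually_ge_atTop (Nat.card A + k)] with n hn hn' f
  refine (h n f).trans (mul_le_mul_of_nonneg_right ?_ (Nat.cast_nonneg _))
  refine le_of_eq_of_le ?_ hn.le
  rw [pow_sub₀ _ hρ0.ne' hn']
  ring

theorem eventually_ncard_not_forall_extensionAxiom_le (H : Subgroup (Equiv.Perm A)) (N : ℕ)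
    {ε : ℝ} (hε : 0 < ε) : ∀ᶠ n : ℕ in atTop, ∀ f : A ↪ Fin n,
      ({S ∈ invariantStructures L H f | ¬ ∀ j < N, S ∈ extensionAxiom L H f j}.ncard : ℝ) ≤
        ε * ((invariantStructures L H f).ncard : ℝ) := by
  induction N generalizing ε with
  | zero =>
    refine Eventually.of_forall fun n f => ?_
    simpa using mul_nonneg hε.le (Nat.cast_nonneg _)
  | succ N ih =>
    filter_upwards [ih (half_pos hε),
      eventually_ncard_not_extensionAxiom_le (L := L) H N (half_pos hε)] with n h₁ h₂ f
    have hsub : {S ∈ invariantStructures L H f | ¬ ∀ j < N + 1, S ∈ extensionAxiom L H f j} ⊆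
        {S ∈ invariantStructures L H f | ¬ ∀ j < N, S ∈ extensionAxiom L H f j} ∪
        {S ∈ invariantStructures L H f | S ∉ extensionAxiom L H f N} := by
      rintro S ⟨hS, h⟩
      by_cases hN : S ∈ extensionAxiom L H f N
      · refine Or.inl ⟨hS, fun h' => h fun j hj => ?_⟩
        rcases Nat.lt_succ_iff_lt_or_eq.1 hj with hj | rfl
        · exact h' j hj
        · exact hN
      · exact Or.inr ⟨hS, hN⟩
    have := (Set.ncard_le_ncard hsub).trans (Set.ncard_union_le _ _)
    have : (({S ∈ invariantStructures L H f |
        ¬ ∀ j < N + 1, S ∈ extensionAxiom L H f j}.ncard : ℕ) : ℝ) ≤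
        {S ∈ invariantStructures L H f | ¬ ∀ j < N, S ∈ extensionAxiom L H f j}.ncard +
        {S ∈ invariantStructures L H f | S ∉ extensionAxiom L H f N}.ncard := by
      exact_mod_cast this
    linarith [h₁ f, h₂ f]

end ExtensionProbability

/-! ### Almost all invariant structures are rigid outside the copy of `A` -/

section Rigidity

variable {L : FirstOrder.Language.{u, v}} {A : Type w} {V : Type*}

/-- The atom `R(x, y, …, y)`, where `p = (x, y)`. -/
def pairAtom {j : ℕ} (R : L.Relations (j + 2)) (p : V × V) :
    Σ k, L.Relations k × (Fin k → V) :=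
  ⟨j + 2, R, Fin.cons p.1 fun _ => p.2⟩

theorem pairAtom_eq_iff {j : ℕ} (R : L.Relations (j + 2)) {p q : V × V} :
    pairAtom R p = pairAtom R q ↔ p = q := by
  refine ⟨fun h => ?_, fun h => h ▸ rfl⟩
  have h₁ := (Prod.ext_iff.1 (eq_of_heq (Sigma.mk.inj_iff.1 h).2)).2
  exact Prod.ext (congrFun h₁ 0) (congrFun h₁ 1)

theorem pairAtom_eq_comp_iff {j : ℕ} (R : L.Relations (j + 2)) (g : Equiv.Perm V) (p : V × V)
    {k : ℕ} (R' : L.Relations k) (s : Fin k → V) :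
    pairAtom R (g p.1, g p.2) = ⟨k, R', g ∘ s⟩ ↔ pairAtom R p = ⟨k, R', s⟩ := by
  have hcons : g ∘ (Fin.cons p.1 fun _ => p.2 : Fin (j + 2) → V) =
      Fin.cons (g p.1) fun _ => g p.2 := Fin.comp_cons _ _ _
  constructor
  · intro h
    obtain ⟨rfl, h⟩ := Sigma.mk.inj_iff.1 h
    obtain ⟨rfl, h⟩ := Prod.ext_iff.1 (eq_of_heq h)
    have : (Fin.cons p.1 fun _ => p.2 : Fin (j + 2) → V) = s :=
      g.injective.comp_left (hcons.trans h)
    rw [← this]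
    rfl
  · intro h
    obtain ⟨rfl, h⟩ := Sigma.mk.inj_iff.1 h
    obtain ⟨rfl, rfl⟩ := Prod.ext_iff.1 (eq_of_heq h)
    rw [hcons]
    rfl

/-- A permutation of which `W` contains no fixed point moves a third of `W` off itself: take a
largest subset of `W` that is disjoint from its image. -/
theorem exists_subset_forall_apply_not_mem [DecidableEq V] (g : Equiv.Perm V) (W : Finset V)
    (hW : ∀ a ∈ W, g a ≠ a) :
    ∃ W₁ ⊆ W, (∀ a ∈ W₁, g a ∉ W₁) ∧ W.card ≤ 3 * W₁.card := by
  obtain ⟨W₁, hW₁, hmax⟩ := Finset.exists_max_image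
    (W.powerset.filter fun W₁ => ∀ a ∈ W₁, g a ∉ W₁) Finset.card ⟨∅, by simp⟩
  simp only [Finset.mem_filter, Finset.mem_powerset] at hW₁ hmax
  refine ⟨W₁, hW₁.1, hW₁.2, ?_⟩
  have hsub : W ⊆ W₁ ∪ (W₁.image g ∪ W₁.image g.symm) := by
    intro a ha
    by_contra hn
    simp only [Finset.mem_union, Finset.mem_image, not_or, not_exists, not_and] at hn
    obtain ⟨h₁, h₂, h₃⟩ := hn
    have := hmax (insert a W₁) ⟨Finset.insert_subset ha hW₁.1, fun b hb => ?_⟩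
    · rw [Finset.card_insert_of_notMem h₁] at this
      omega
    · rw [Finset.mem_insert] at hb ⊢
      rintro (h | h)
      · rcases hb with rfl | hb
        · exact hW b ha h
        · exact h₂ b hb h
      · rcases hb with rfl | hb
        · exact h₃ _ h (g.symm_apply_apply b)
        · exact hW₁.2 b hb h
  calc W.card ≤ _ := Finset.card_le_card hsub
    _ ≤ W₁.card + ((W₁.image g).card + (W₁.image g.symm).card) :=
      (Finset.card_union_le _ _).trans (Nat.add_le_add_left (Finset.card_union_le _ _) _)
    _ ≤ 3 * W₁.card := by
      have := Finset.card_image_le (s := W₁) (f := g)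
      have := Finset.card_image_le (s := W₁) (f := g.symm)
      omega

variable [L.Structure A] [L.IsRelational] [Finite (Σ k, L.Relations k)]

/-- The atoms `R(x, y, …, y)` with `x ∈ W` and `y ∈ Y` may be changed at will in an invariant
structure, but in a structure with automorphism `g` they are determined by the atoms
`R(g x, g y, …, g y)`, none of which is among them. -/
theorem ncard_autGroup_mul_le [Finite V] (H : Subgroup (Equiv.Perm A)) (f : A ↪ V) {j : ℕ}
    (R : L.Relations (j + 2)) (g : Equiv.Perm V) (W Y : Finset V)
    (hWf : ∀ a ∈ W, a ∉ Set.range f) (hYf : ∀ a ∈ Y, a ∉ Set.range f) (hW : ∀ a ∈ W, g a ∉ W) :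
    {S ∈ invariantStructures L H f | g ∈ @autGroup L V S}.ncard * 2 ^ (W.card * Y.card) ≤
      (invariantStructures L H f).ncard := by
  classical
  set T : Finset (V × V) := W ×ˢ Y with hT
  have hTcard : 2 ^ (W.card * Y.card) = ((T.powerset : Finset (Finset (V × V))) :
      Set (Finset (V × V))).ncard := by
    rw [Set.ncard_coe_finset, Finset.card_powerset, Finset.card_product]
  let D : Finset (V × V) → ∀ k, L.Relations k → (Fin k → V) → Prop :=
    fun b k R' s => ∃ p ∈ b, pairAtom R p = ⟨k, R', s⟩
  have hDmem : ∀ (b : Finset (V × V)) (p : V × V),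
      D b (j + 2) R (Fin.cons p.1 fun _ => p.2) ↔ p ∈ b := by
    intro b p
    constructor
    · rintro ⟨q, hq, h⟩
      rwa [← (pairAtom_eq_iff R).1 h]
    · exact fun h => ⟨p, h, rfl⟩
  have hDinv : ∀ b ⊆ T, ∀ (σ : Equiv.Perm A) k (R' : L.Relations k) (s : Fin k → V),
      D b k R' (σ.viaEmbedding f ∘ s) ↔ D b k R' s := by
    intro b hb σ k R' s
    refine exists_congr fun p => and_congr_right fun hp => ?_
    have hp' := Finset.mem_product.1 (hb hp)
    rw [← pairAtom_eq_comp_iff R (σ.viaEmbedding f) p R' s,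
      Equiv.Perm.viaEmbedding_apply_of_notMem _ _ _ (hWf _ hp'.1),
      Equiv.Perm.viaEmbedding_apply_of_notMem _ _ _ (hYf _ hp'.2)]
  rw [hTcard, ← Set.ncard_prod]
  refine Set.ncard_le_ncard_of_injOn (fun x => patch (D T) (D x.2) x.1) ?_ ?_
  · rintro ⟨S, b⟩ ⟨⟨hS, -⟩, hb⟩
    have hb : b ⊆ T := Finset.mem_powerset.1 hb
    refine patch_mem_invariantStructures hS ?_ (fun σ _ => hDinv T subset_rfl σ)
      (fun σ _ k R' s _ => hDinv b hb σ k R' s)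
    rintro k R' t ⟨p, hp, h⟩
    obtain ⟨rfl, h⟩ := Sigma.mk.inj_iff.1 h
    exact hWf _ (Finset.mem_product.1 hp).1
      ⟨t 0, (congrFun (Prod.ext_iff.1 (eq_of_heq h)).2 0).symm⟩
  · rintro ⟨S, b⟩ ⟨⟨hS, hgS⟩, hb⟩ ⟨S', b'⟩ ⟨⟨hS', hgS'⟩, hb'⟩ h
    have hb : b ⊆ T := Finset.mem_powerset.1 hb
    have hb' : b' ⊆ T := Finset.mem_powerset.1 hb'
    have hrel : ∀ k (R' : L.Relations k) s,
        rel (patch (D T) (D b) S) R' s ↔ rel (patch (D T) (D b') S') R' s :=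
      fun k R' s => iff_of_eq (congrArg (fun M => rel M R' s) h)
    have hoff : ∀ k (R' : L.Relations k) s, ¬ D T k R' s → (rel S R' s ↔ rel S' R' s) := by
      intro k R' s hs
      have := hrel k R' s
      rwa [rel_patch_of_not_mem hs, rel_patch_of_not_mem hs] at this
    refine Prod.ext (structure_ext fun k R' s => ?_) (Finset.ext fun p => ?_)
    · by_cases hs : D T k R' s
      · rw [← mem_autGroup_iff.1 hgS k R' s, ← mem_autGroup_iff.1 hgS' k R' s]
        apply hoff
        rintro ⟨q, hq, hqs⟩
        obtain ⟨p, hp, hps⟩ := hs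
        have := (pairAtom_eq_comp_iff R g p R' s).2 hps
        rw [← hqs, pairAtom_eq_iff] at this
        apply hW p.1 (Finset.mem_product.1 hp).1
        have h₁ : g p.1 = q.1 := congrArg Prod.fst this
        rw [h₁]
        exact (Finset.mem_product.1 hq).1
      · exact hoff k R' s hs
    · by_cases hp : p ∈ T
      · have := hrel _ R (Fin.cons p.1 fun _ => p.2)
        rwa [rel_patch_of_mem ((hDmem T p).2 hp), rel_patch_of_mem ((hDmem T p).2 hp), hDmem,
          hDmem] at this
      · exact iff_of_false (fun h => hp (hb h)) (fun h => hp (hb' h))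

variable [Finite A]

/-- A permutation that moves `#W` elements outside the copy of `A` is an automorphism with
probability at most `2 ^ (-2 e #W)`, where `e` is a sixth of the number of elements outside the
copy. The exponent is a multiple of `2 #W` so that one power of `2 ^ (-e)` can be split off from the
union bound. -/
theorem ncard_autGroup_le [DecidableEq V] [Fintype V] (H : Subgroup (Equiv.Perm A)) (f : A ↪ V)
    {j : ℕ} (R : L.Relations (j + 2)) (g : Equiv.Perm V) (W : Finset V)
    (hW : ∀ a ∈ W, a ∉ Set.range f ∧ g a ≠ a) :
    ({S ∈ invariantStructures L H f | g ∈ @autGroup L V S}.ncard : ℝ) ≤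
      ((1 / 2 : ℝ) ^ ((Fintype.card V - Nat.card A) / 6)) ^ (2 * W.card) *
        ((invariantStructures L H f).ncard : ℝ) := by
  classical
  have := Fintype.ofFinite A
  obtain ⟨W₁, hsub, hW₁, hcard⟩ := exists_subset_forall_apply_not_mem g W fun a ha => (hW a ha).2
  let Y : Finset V := (Finset.univ.image f)ᶜ
  have hY : Y.card = Fintype.card V - Nat.card A := by
    rw [Finset.card_compl, Finset.card_image_of_injective _ f.injective, Finset.card_univ,
      Nat.card_eq_fintype_card]
  have h := ncard_autGroup_mul_le H f R g W₁ Y (fun a ha => (hW a (hsub ha)).1)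
    (fun a ha => by simpa [Y] using ha) hW₁
  set e := (Fintype.card V - Nat.card A) / 6 with he
  have hexp : e * (2 * W.card) ≤ W₁.card * Y.card := by
    have h6 : 6 * e ≤ Y.card := by
      rw [hY, he]
      exact Nat.mul_div_le _ _
    calc e * (2 * W.card) ≤ e * (2 * (3 * W₁.card)) := by gcongr
      _ = W₁.card * (6 * e) := by ring
      _ ≤ _ := by gcongr
  have h2 : {S ∈ invariantStructures L H f | g ∈ @autGroup L V S}.ncard * 2 ^ (e * (2 * W.card)) ≤
      (invariantStructures L H f).ncard :=
    (Nat.mul_le_mul_left _ (Nat.pow_le_pow_right (by norm_num) hexp)).trans h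
  have h3 : ({S ∈ invariantStructures L H f | g ∈ @autGroup L V S}.ncard : ℝ) *
      2 ^ (e * (2 * W.card)) ≤ ((invariantStructures L H f).ncard : ℝ) := by exact_mod_cast h2
  rw [← pow_mul, one_div, inv_pow, ← div_eq_inv_mul, le_div_iff₀ (by positivity)]
  exact h3

/-- The union bound over the permutations `g` that move an element outside the range of `f`, each
weighted by a power of `p` with exponent the number of these elements. The sum of the weights
over all maps factors over the elements. -/
theorem ncard_not_rigidOutside_le (H : Subgroup (Equiv.Perm A)) {j : ℕ} (R : L.Relations (j + 2))
    {n : ℕ} (f : A ↪ Fin n) {p : ℝ} (hp : p = (1 / 2 : ℝ) ^ ((n - Nat.card A) / 6)) :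
    ({S ∈ invariantStructures L H f | S ∉ rigidOutside L f}.ncard : ℝ) ≤
      p * ((n : ℝ) ^ Nat.card A * (1 + n * p) ^ n) * ((invariantStructures L H f).ncard : ℝ) := by
  classical
  have := Fintype.ofFinite A
  have hp0 : 0 < p := by rw [hp]; positivity
  have hp1 : p ≤ 1 := by rw [hp]; exact pow_le_one₀ (by norm_num) (by norm_num)
  set U := invariantStructures L H f with hU
  let W : (Fin n → Fin n) → Finset (Fin n) :=
    fun g => Finset.univ.filter fun a => a ∉ Set.range f ∧ g a ≠ a
  let bad : Equiv.Perm (Fin n) → Set (L.Structure (Fin n)) :=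
    fun g => {S | S ∈ U ∧ g ∈ @autGroup L (Fin n) S ∧ (W g).Nonempty}
  have hcover : {S ∈ U | S ∉ rigidOutside L f} ⊆ ⋃ g, bad g := by
    rintro S ⟨hSU, hS⟩
    simp only [rigidOutside, Set.mem_ofPred_eq] at hS
    push Not at hS
    obtain ⟨g, hg, a, ha, hga⟩ := hS
    exact Set.mem_iUnion.2 ⟨g, hSU, hg, a, by simpa [W] using ⟨by simpa using ha, hga⟩⟩
  have hbad : ∀ g, ((bad g).ncard : ℝ) ≤ p * p ^ (W g).card * (U.ncard : ℝ) := by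
    intro g
    rcases (W g).eq_empty_or_nonempty with hW | hW
    · have : bad g = ∅ := by
        ext S
        simp only [Set.mem_empty_iff_false, iff_false]
        exact fun hS => hS.2.2.ne_empty hW
      rw [this, Set.ncard_empty, Nat.cast_zero]
      positivity
    · have h := ncard_autGroup_le H f R g (W g) fun a ha => by simpa [W] using ha
      rw [Fintype.card_fin, ← hp] at h
      have hsub : ((bad g).ncard : ℝ) ≤ ({S ∈ U | g ∈ @autGroup L (Fin n) S}.ncard : ℝ) := by
        have : bad g ⊆ {S ∈ U | (g : Equiv.Perm (Fin n)) ∈ @autGroup L (Fin n) S} :=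
          fun S hS => ⟨hS.1, hS.2.1⟩
        exact_mod_cast Set.ncard_le_ncard this
      refine (hsub.trans h).trans (mul_le_mul_of_nonneg_right ?_ (Nat.cast_nonneg _))
      -- `p ^ (2 t) ≤ p * p ^ t` as `t ≥ 1`
      rw [← pow_succ']
      have := hW.card_pos
      exact pow_le_pow_of_le_one hp0.le hp1 (by omega)
  let wt : Fin n → Fin n → ℝ := fun a b => if a ∉ Set.range f ∧ b ≠ a then p else 1
  have hwt : ∀ a b, 0 ≤ wt a b := fun a b => by
    simp only [wt]
    split_ifs
    · exact hp0.le
    · exact zero_le_one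
  have hprod : ∀ g : Fin n → Fin n, p ^ (W g).card = ∏ a, wt a (g a) := by
    intro g
    simp only [wt, W]
    rw [Finset.prod_ite, Finset.prod_const, Finset.prod_const_one, mul_one]
  have hrow : ∀ a, ∑ b, wt a b ≤ if a ∈ Set.range f then (n : ℝ) else 1 + n * p := by
    intro a
    split_ifs with ha
    · simp only [wt, ha, not_true_eq_false, false_and, if_false]
      simp
    · calc ∑ b, wt a b ≤ ∑ b, ((if b = a then 1 else 0) + p) := by
            refine Finset.sum_le_sum fun b _ => ?_
            simp only [wt]
            by_cases hb : b = a
            · simp [hb, hp0.le]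
            · simp [hb, ha]
        _ = 1 + n * p := by
            rw [Finset.sum_add_distrib]
            simp
  have hsum : ∑ g : Equiv.Perm (Fin n), p ^ (W g).card ≤
      (n : ℝ) ^ Nat.card A * (1 + n * p) ^ n := by
    calc ∑ g : Equiv.Perm (Fin n), p ^ (W g).card
        = ∑ h ∈ Finset.univ.image (fun g : Equiv.Perm (Fin n) => (g : Fin n → Fin n)),
            p ^ (W h).card := by
          rw [Finset.sum_image fun g _ g' _ h => Equiv.coe_fn_injective h]
      _ ≤ ∑ h : Fin n → Fin n, p ^ (W h).card :=
          Finset.sum_le_sum_of_subset_of_nonneg (Finset.subset_univ _) fun h _ _ => by positivity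
      _ = ∏ a, ∑ b, wt a b := by
          rw [Finset.prod_univ_sum, Fintype.piFinset_univ]
          exact Finset.sum_congr rfl fun h _ => hprod h
      _ ≤ ∏ a : Fin n, if a ∈ Set.range f then (n : ℝ) else 1 + n * p :=
          Finset.prod_le_prod (fun a _ => Finset.sum_nonneg fun b _ => hwt a b) fun a _ => hrow a
      _ = (n : ℝ) ^ Nat.card A *
            (1 + n * p) ^ (Finset.univ.filter fun a => a ∉ Set.range f).card := by
          rw [Finset.prod_ite, Finset.prod_const, Finset.prod_const]
          congr 2
          have : (Finset.univ.filter fun a => a ∈ Set.range f) = Finset.univ.image f := by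
            ext a
            simp
          rw [this, Finset.card_image_of_injective _ f.injective, Finset.card_univ,
            Nat.card_eq_fintype_card]
      _ ≤ _ := by
          refine mul_le_mul_of_nonneg_left (pow_le_pow_right₀ ?_ ?_) (by positivity)
          · have : 0 ≤ n * p := by positivity
            linarith
          · exact (Finset.card_le_univ _).trans_eq (Fintype.card_fin n)
  calc ({S ∈ U | S ∉ rigidOutside L f}.ncard : ℝ) ≤ ∑ g, ((bad g).ncard : ℝ) := by
        exact_mod_cast ncard_le_sum_of_subset_iUnion hcover
    _ ≤ ∑ g : Equiv.Perm (Fin n), p * p ^ (W g).card * (U.ncard : ℝ) :=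
        Finset.sum_le_sum fun g _ => hbad g
    _ = p * (∑ g : Equiv.Perm (Fin n), p ^ (W g).card) * (U.ncard : ℝ) := by
        rw [Finset.mul_sum, Finset.sum_mul]
    _ ≤ _ := by gcongr

theorem tendsto_pow_mul_half_pow_div_six (c m : ℕ) :
    Tendsto (fun n : ℕ => (n : ℝ) ^ c * (1 / 2 : ℝ) ^ ((n - m) / 6)) atTop (𝓝 0) := by
  have ht : Tendsto (fun n : ℕ => (n : ℝ) ^ c * (9 / 10 : ℝ) ^ n * (1 / (9 / 10) ^ (m + 6)))
      atTop (𝓝 (0 * (1 / (9 / 10) ^ (m + 6)))) :=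
    (tendsto_pow_const_mul_const_pow_of_abs_lt_one c
      (by rw [abs_of_pos] <;> norm_num)).mul_const _
  rw [zero_mul] at ht
  refine squeeze_zero' (Eventually.of_forall fun n => by positivity) ?_ ht
  filter_upwards [eventually_ge_atTop (m + 6)] with n hn
  rw [mul_assoc]
  refine mul_le_mul_of_nonneg_left ?_ (by positivity)
  -- `1 / 2 ≤ (9 / 10) ^ 6`
  calc (1 / 2 : ℝ) ^ ((n - m) / 6) ≤ ((9 / 10 : ℝ) ^ 6) ^ ((n - m) / 6) :=
        pow_le_pow_left₀ (by norm_num) (by norm_num) _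
    _ = (9 / 10 : ℝ) ^ (6 * ((n - m) / 6)) := (pow_mul _ _ _).symm
    _ ≤ (9 / 10 : ℝ) ^ (n - (m + 6)) :=
        pow_le_pow_of_le_one (by norm_num) (by norm_num) (by omega)
    _ = _ := by rw [pow_sub₀ _ (by norm_num) hn, one_div]

theorem eventually_ncard_not_rigidOutside_le (H : Subgroup (Equiv.Perm A)) {j : ℕ}
    (R : L.Relations (j + 2)) {ε : ℝ} (hε : 0 < ε) : ∀ᶠ n : ℕ in atTop, ∀ f : A ↪ Fin n,
      ({S ∈ invariantStructures L H f | S ∉ rigidOutside L f}.ncard : ℝ) ≤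
        ε * ((invariantStructures L H f).ncard : ℝ) := by
  have h₁ := tendsto_pow_mul_half_pow_div_six 2 (Nat.card A)
  have h₂ := (tendsto_pow_mul_half_pow_div_six (Nat.card A) (Nat.card A)).mul_const (Real.exp 1)
  rw [zero_mul] at h₂
  filter_upwards [h₁.eventually_lt_const one_pos, h₂.eventually_lt_const hε] with n hn₁ hn₂ f
  refine (ncard_not_rigidOutside_le H R f rfl).trans
    (mul_le_mul_of_nonneg_right ?_ (Nat.cast_nonneg _))
  set p : ℝ := (1 / 2 : ℝ) ^ ((n - Nat.card A) / 6) with hp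
  have hp0 : 0 < p := by rw [hp]; positivity
  have hexp : (1 + n * p) ^ n ≤ Real.exp 1 := by
    calc (1 + n * p) ^ n ≤ Real.exp (n * p) ^ n := by
          refine pow_le_pow_left₀ (by positivity) ?_ n
          rw [add_comm]
          exact Real.add_one_le_exp _
      _ = Real.exp (n ^ 2 * p) := by
          rw [← Real.exp_nat_mul]
          ring_nf
      _ ≤ Real.exp 1 := Real.exp_le_exp.2 hn₁.le
  calc p * ((n : ℝ) ^ Nat.card A * (1 + n * p) ^ n)
      ≤ p * ((n : ℝ) ^ Nat.card A * Real.exp 1) := by gcongr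
    _ = (n : ℝ) ^ Nat.card A * p * Real.exp 1 := by ring
    _ ≤ ε := hn₂.le

end Rigidity

/-! ### The zero-one law -/

section ZeroOneLaw

variable {L : FirstOrder.Language.{u, v}} [L.IsRelational] [Finite (Σ k, L.Relations k)]
  {A : Type w} [Finite A] [L.Structure A] {H : Subgroup (Equiv.Perm A)}

/-- A structure in the class arises from at most `|A| ^ |A|` embeddings, as they all have the
same range, namely its support. -/
theorem sum_ncard_le (hH : HasNoFixedPoint H) [Fintype A] (n : ℕ) :
    ∑ f : A ↪ Fin n, (invariantStructures L H f ∩ rigidOutside L f).ncard ≤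
      (classS L A H n).ncard * Nat.card (A → A) := by
  classical
  have := Fintype.ofFinite (L.Structure (Fin n))
  rcases isEmpty_or_nonempty (A ↪ Fin n) with hempty | hnonempty
  · simp
  let Good : Set ((A ↪ Fin n) × L.Structure (Fin n)) :=
    {x | x.2 ∈ invariantStructures L H x.1 ∧ x.2 ∈ rigidOutside L x.1}
  have hsum : ∑ f : A ↪ Fin n, (invariantStructures L H f ∩ rigidOutside L f).ncard =
      Good.ncard := by
    have : Good = ((Finset.univ.sigma fun f : A ↪ Fin n =>
        (invariantStructures L H f ∩ rigidOutside L f).toFinset).map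
          (Equiv.sigmaEquivProd (A ↪ Fin n) (L.Structure (Fin n))).toEmbedding : Finset _) := by
      ext ⟨f, S⟩
      simp [Good]
    rw [this, Set.ncard_coe_finset, Finset.card_map, Finset.card_sigma]
    exact Finset.sum_congr rfl fun f _ => Set.ncard_eq_toFinset_card' _
  have hrange : ∀ x ∈ Good, Set.range x.1 = @support L (Fin n) x.2 :=
    fun x hx => range_eq_support hH hx.1 hx.2
  have hex : ∀ S ∈ classS L A H n, ∃ f : A ↪ Fin n, Set.range f = @support L (Fin n) S := by
    intro S hS
    obtain ⟨f, hf⟩ := (mem_classS_iff hH).1 hS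
    exact ⟨f, hrange (f, S) hf⟩
  -- the embeddings with a given range are compared with one of them, chosen by `c`
  choose! c hc using hex
  have hclass : ∀ x ∈ Good, x.2 ∈ classS L A H n := fun x hx => (mem_classS_iff hH).2 ⟨x.1, hx⟩
  have hpre : ∀ x : (A ↪ Fin n) × L.Structure (Fin n), ∃ τ : A → A,
      x ∈ Good → ∀ a, c x.2 (τ a) = x.1 a := by
    intro x
    by_cases hx : x ∈ Good
    · have : ∀ a, ∃ b, c x.2 b = x.1 a := fun a => by
        have h : x.1 a ∈ Set.range (c x.2) := by
          rw [hc _ (hclass x hx), ← hrange x hx]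
          exact ⟨a, rfl⟩
        exact h
      choose τ hτ using this
      exact ⟨τ, fun _ => hτ⟩
    · exact ⟨id, fun h => absurd h hx⟩
  choose τ hτ using hpre
  rw [hsum, ← Set.ncard_univ (A → A), ← Set.ncard_prod]
  refine Set.ncard_le_ncard_of_injOn (fun x => (x.2, τ x))
    (fun x hx => ⟨hclass x hx, Set.mem_univ _⟩) ?_
  rintro ⟨f, S⟩ hx ⟨f', S'⟩ hx' h
  obtain ⟨rfl, h₂⟩ := Prod.ext_iff.1 h
  refine Prod.ext (Function.Embedding.ext fun a => ?_) rfl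
  have h₁ := hτ _ hx a
  have h₃ := hτ _ hx' a
  simp only at h₁ h₂ h₃
  rw [← h₁, ← h₃, h₂]

/-- If almost all invariant structures are rigid outside the copy of `A`, then a sentence that
fails in almost all invariant structures, uniformly in `f`, fails in almost all structures of the
class. -/
theorem tendsto_proportion_zero (hH : HasNoFixedPoint H)
    (hrigid : ∀ᶠ n : ℕ in atTop, ∀ f : A ↪ Fin n,
      ({S ∈ invariantStructures L H f | S ∉ rigidOutside L f}.ncard : ℝ) ≤
        1 / 2 * ((invariantStructures L H f).ncard : ℝ)) (φ : L.Sentence)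
    (hφ : ∀ ε > (0 : ℝ), ∀ᶠ n : ℕ in atTop, ∀ f : A ↪ Fin n,
      ({S ∈ invariantStructures L H f |
        @FirstOrder.Language.Sentence.Realize L (Fin n) S φ}.ncard : ℝ) ≤
        ε * ((invariantStructures L H f).ncard : ℝ)) :
    Tendsto (fun n => proportion (classS L A H n) φ) atTop (𝓝 0) := by
  classical
  have := Fintype.ofFinite A
  have hC : (0 : ℝ) < Nat.card (A → A) := by
    have : Nonempty (A → A) := ⟨id⟩
    exact_mod_cast Nat.card_pos
  rw [Metric.tendsto_nhds]
  intro ε hε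
  have hδ : 0 < ε / (4 * Nat.card (A → A)) := by positivity
  filter_upwards [hrigid, hφ _ hδ] with n h₁ h₂
  have hpos : 0 ≤ proportion (classS L A H n) φ :=
    div_nonneg (Nat.cast_nonneg _) (Nat.cast_nonneg _)
  rw [Real.dist_eq, sub_zero, abs_of_nonneg hpos]
  refine lt_of_le_of_lt ?_ (half_lt_self hε)
  refine div_le_of_le_mul₀ (Nat.cast_nonneg _) (half_pos hε).le ?_
  have hcover : {S ∈ classS L A H n | @FirstOrder.Language.Sentence.Realize L (Fin n) S φ} ⊆
      ⋃ f : A ↪ Fin n, {S ∈ invariantStructures L H f |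
        @FirstOrder.Language.Sentence.Realize L (Fin n) S φ} := by
    rintro S ⟨hS, hSφ⟩
    obtain ⟨f, hf, -⟩ := (mem_classS_iff hH).1 hS
    exact Set.mem_iUnion.2 ⟨f, hf, hSφ⟩
  have hgood : ∀ f : A ↪ Fin n, ((invariantStructures L H f).ncard : ℝ) ≤
      2 * ((invariantStructures L H f ∩ rigidOutside L f).ncard : ℝ) := by
    intro f
    have h : (invariantStructures L H f ∩ rigidOutside L f).ncard +
        {S ∈ invariantStructures L H f | S ∉ rigidOutside L f}.ncard =
        (invariantStructures L H f).ncard :=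
      Set.ncard_inter_add_ncard_sdiff_eq_ncard _ _
    have h' : ((invariantStructures L H f ∩ rigidOutside L f).ncard : ℝ) +
        ({S ∈ invariantStructures L H f | S ∉ rigidOutside L f}.ncard : ℝ) =
        ((invariantStructures L H f).ncard : ℝ) := by exact_mod_cast h
    linarith [h₁ f]
  have hsum : (∑ f : A ↪ Fin n, ((invariantStructures L H f ∩ rigidOutside L f).ncard : ℝ)) ≤
      ((classS L A H n).ncard : ℝ) * Nat.card (A → A) := by
    exact_mod_cast sum_ncard_le (L := L) hH n
  calc ({S ∈ classS L A H n |
        @FirstOrder.Language.Sentence.Realize L (Fin n) S φ}.ncard : ℝ)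
      ≤ ∑ f : A ↪ Fin n, ({S ∈ invariantStructures L H f |
        @FirstOrder.Language.Sentence.Realize L (Fin n) S φ}.ncard : ℝ) := by
        exact_mod_cast ncard_le_sum_of_subset_iUnion hcover
    _ ≤ ∑ f : A ↪ Fin n, ε / (4 * Nat.card (A → A)) *
          (2 * ((invariantStructures L H f ∩ rigidOutside L f).ncard : ℝ)) :=
        Finset.sum_le_sum fun f _ =>
          (h₂ f).trans (mul_le_mul_of_nonneg_left (hgood f) hδ.le)
    _ = ε / (2 * Nat.card (A → A)) *
          ∑ f : A ↪ Fin n, ((invariantStructures L H f ∩ rigidOutside L f).ncard : ℝ) := by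
        rw [Finset.mul_sum]
        refine Finset.sum_congr rfl fun f _ => ?_
        field_simp
        ring
    _ ≤ ε / (2 * Nat.card (A → A)) * (((classS L A H n).ncard : ℝ) * Nat.card (A → A)) :=
        mul_le_mul_of_nonneg_left hsum (by positivity)
    _ = ε / 2 * ((classS L A H n).ncard : ℝ) := by
        field_simp

theorem eventually_classS_nonempty (hHA : H ≤ autGroup L A) (hH : HasNoFixedPoint H)
    (hrigid : ∀ᶠ n : ℕ in atTop, ∀ f : A ↪ Fin n,
      ({S ∈ invariantStructures L H f | S ∉ rigidOutside L f}.ncard : ℝ) ≤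
        1 / 2 * ((invariantStructures L H f).ncard : ℝ)) :
    ∀ᶠ n in atTop, (classS L A H n).Nonempty := by
  have := Fintype.ofFinite A
  filter_upwards [hrigid, eventually_ge_atTop (Fintype.card A)] with n h hn
  obtain ⟨f⟩ : Nonempty (A ↪ Fin n) :=
    Function.Embedding.nonempty_of_card_le (by rwa [Fintype.card_fin])
  by_contra hne
  have hall : {S ∈ invariantStructures L H f | S ∉ rigidOutside L f} =
      invariantStructures L H f :=
    Set.Subset.antisymm (fun S hS => hS.1)
      fun S hS => ⟨hS, fun hr => hne ⟨S, (mem_classS_iff hH).2 ⟨f, hS, hr⟩⟩⟩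
  have hf := h f
  rw [hall] at hf
  have hpos : (0 : ℝ) < (invariantStructures L H f).ncard := by
    exact_mod_cast (Set.ncard_pos).2 (invariantStructures_nonempty hHA f)
  linarith

theorem proportion_not {n : ℕ} {C : Set (L.Structure (Fin n))} (hC : C.Nonempty)
    (φ : L.Sentence) : proportion C φ = 1 - proportion C φ.not := by
  have h : {S ∈ C | @FirstOrder.Language.Sentence.Realize L (Fin n) S φ}.ncard +
      {S ∈ C | @FirstOrder.Language.Sentence.Realize L (Fin n) S φ.not}.ncard = C.ncard := by
    exact Set.ncard_inter_add_ncard_sdiff_eq_ncard C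
      {S | @FirstOrder.Language.Sentence.Realize L (Fin n) S φ}
  have hpos : (0 : ℝ) < C.ncard := by exact_mod_cast (Set.ncard_pos).2 hC
  have h' : ({S ∈ C | @FirstOrder.Language.Sentence.Realize L (Fin n) S φ}.ncard : ℝ) +
      ({S ∈ C | @FirstOrder.Language.Sentence.Realize L (Fin n) S φ.not}.ncard : ℝ) =
      C.ncard := by exact_mod_cast h
  rw [proportion, proportion, eq_sub_iff_add_eq, ← add_div, h', div_self hpos.ne']

end ZeroOneLaw

end SupportZeroOne

theorem mainTheorem3 (L : FirstOrder.Language.{_, _}) [L.IsRelational]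
    [Finite (Σ k, L.Relations k)] (hr : ∃ k, 2 ≤ k ∧ Nonempty (L.Relations k))
    (A : Type*) [Finite A] [Nonempty A] [L.Structure A]
    (hA : SupportZeroOne.HasNoFixedPoint (SupportZeroOne.autGroup L A))
    (H : Subgroup (Equiv.Perm A)) (hHA : H ≤ SupportZeroOne.autGroup L A)
    (hH : SupportZeroOne.HasNoFixedPoint H) :
    SupportZeroOne.HasZeroOneLaw (SupportZeroOne.classS L A H) := by
  open SupportZeroOne in
  obtain ⟨k, hk, ⟨R⟩⟩ := hr
  obtain ⟨j, rfl⟩ := Nat.exists_eq_add_of_le' hk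
  have hrigid := eventually_ncard_not_rigidOutside_le (A := A) H R (ε := 1 / 2) (by norm_num)
  have hne := eventually_classS_nonempty hHA hH hrigid
  refine ⟨hne, fun φ => ?_⟩
  obtain ⟨N, hN⟩ := exists_sentence_realize_iff H φ
  by_cases h : ∃ (n₀ : ℕ) (f₀ : A ↪ Fin n₀) (S₀ : L.Structure (Fin n₀)),
      S₀ ∈ invariantStructures L H f₀ ∧ (∀ i < N, S₀ ∈ extensionAxiom L H f₀ i) ∧
      @FirstOrder.Language.Sentence.Realize L (Fin n₀) S₀ φ
  · obtain ⟨n₀, f₀, S₀, hS₀, hext₀, hφ₀⟩ := h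
    right
    have hnot : Tendsto (fun n => proportion (classS L A H n) φ.not) atTop (𝓝 0) := by
      refine tendsto_proportion_zero hH hrigid _ fun ε hε => ?_
      filter_upwards [eventually_ncard_not_forall_extensionAxiom_le (L := L) H N hε] with n hn f
      refine le_trans ?_ (hn f)
      refine Nat.cast_le.2 (Set.ncard_le_ncard fun S hS => ⟨hS.1, fun hext => hS.2 ?_⟩)
      exact (hN _ _ f₀ f S₀ S hS₀ hS.1 hext₀ hext).1 hφ₀
    have h₁ := hnot.const_sub 1
    rw [sub_zero] at h₁
    exact h₁.congr' (hne.mono fun n hn => (proportion_not hn φ).symm)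
  · left
    refine tendsto_proportion_zero hH hrigid _ fun ε hε => ?_
    filter_upwards [eventually_ncard_not_forall_extensionAxiom_le (L := L) H N hε] with n hn f
    refine le_trans ?_ (hn f)
    exact Nat.cast_le.2 (Set.ncard_le_ncard fun S hS => ⟨hS.1, fun hext =>
      h ⟨n, f, S, hS.1, hext, hS.2⟩⟩)
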